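/- Let $d\ge 1$, let $\rho$ be the Euclidean distance in $\mathbb{R}^d$, $B(x,r)=\{y:\rho(x,y)\le r\}$ and $V_d=\pi^{d/2}/\Gamma(d/2+1)$. Put $G(t)=0$ for $0\le t<1$ and $G(t)=t\log t$ for $t\ge 1$. For a probability density $f$ in $\mathbb{R}^d$ (with respect to Lebesgue measure), $x\in\mathbb{R}^d$ and $r,R>0$ set $$I_f(x,r)=\frac{1}{r^dV_d}\int_{B(x,r)}f(y)\,dy,\qquad M_f(x,R)=\sup_{r\in(0,R]}I_f(x,r),\qquad m_f(x,R)=\inf_{r\in(0,R]}I_f(x,r),$$ and for $\varepsilon>0$ define the following functionals with values in $[0,\infty]$: $$K_f(\varepsilon)=\int_{\mathbb{R}^d}\Big(\int_{\mathbb{R}^d\setminus\{x\}}G\big(|\log\rho(x,y)|\big)f(y)\,dy\Big)^{1+\varepsilon}f(x)\,dx,$$ $$Q_f(\varepsilon,R)=\int_{\mathbb{R}^d}M_f(x,R)^{\varepsilon}f(x)\,dx,\qquad T_f(\varepsilon,R)=\int_{\mathbb{R}^d}m_f(x,R)^{-\varepsilon}f(x)\,dx,$$ where $1/0:=\infty$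 and $0\cdot\infty:=0$. Let $X_1,X_2,\ldots$ be i.i.d. random vectors in $\mathbb{R}^d$ with density $f$. For $N\ge 2$ let $\rho_i=\min\{\rho(X_i,X_j): 1\le j\le N,\ j\ne i\}$, $\overline{\rho}=(\rho_1\cdots\rho_N)^{1/N}$ and let $$H_N=d\log\overline{\rho}+\log V_d+\gamma+\log(N-1),\qquad \gamma=-\int_{(0,\infty)}e^{-t}\log t\,dt,$$ be the Kozachenko--Leonenko estimate. If, for some $\varepsilon>0$, the quantities $K_f(\varepsilon)$, $Q_f(\varepsilon,\varepsilon)$ and $T_f(\varepsilon,\varepsilon)$ are all finite, then $f\log f$ is integrable (with $0\log 0:=0$), so that the entropy $H=-\int_{\mathbb{R}^d}f(x)\log f(x)\,dx$ is finite; $H_N$ is integrable for all sufficiently large $N$; and $$\lim_{N\to\infty}\mathsf{E}H_N=H.$$ -/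

import Mathlib

open MeasureTheory ProbabilityTheory Filter Topology
open scoped ENNReal

namespace KozachenkoLeonenko

noncomputable section

/-- `f` is a probability density with respect to the Lebesgue measure of `ℝ^d`. -/
structure IsProbDensity {d : ℕ} (f : EuclideanSpace ℝ (Fin d) → ℝ) : Prop where
  nonneg : ∀ x, 0 ≤ f x
  integrable : Integrable f volume
  integral_eq_one : ∫ x, f x = 1

/-- The probability law on `ℝ^d` whose Lebesgue density is `f`. -/
def densityLaw {d : ℕ} (f : EuclideanSpace ℝ (Fin d) → ℝ) :
    Measure (EuclideanSpace ℝ (Fin d)) :=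
  volume.withDensity (fun x => ENNReal.ofReal (f x))

/-- The (differential) Shannon entropy of a density; `Real.log 0 = 0` gives `0 log 0 = 0`. -/
def entropy {d : ℕ} (f : EuclideanSpace ℝ (Fin d) → ℝ) : ℝ :=
  -∫ x, f x * Real.log (f x)

/-- The volume of the Euclidean unit ball of `ℝ^d`. -/
def ballVol (d : ℕ) : ℝ :=
  Real.pi ^ ((d : ℝ) / 2) / Real.Gamma ((d : ℝ) / 2 + 1)

/-- Euler's constant, as minus the integral of `exp (-t) * log t` over the half-line. -/
def eulerGamma : ℝ :=
  -∫ t in Set.Ioi (0 : ℝ), Real.exp (-t) * Real.log t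

/-- The distance from the `i`-th sample point to its nearest neighbour among the other points.
For `N ≥ 2` this is an infimum over a finite nonempty set, hence a minimum. -/
def nearestDist {d N : ℕ} (x : Fin N → EuclideanSpace ℝ (Fin d)) (i : Fin N) : ℝ :=
  ⨅ j : {j : Fin N // j ≠ i}, dist (x i) (x j)

/-- The geometric mean of the nearest neighbour distances. -/
def meanDist {d N : ℕ} (x : Fin N → EuclideanSpace ℝ (Fin d)) : ℝ :=
  (∏ i, nearestDist x i) ^ (1 / (N : ℝ))

/-- The Kozachenko-Leonenko estimate computed from a sample of `N ≥ 2` points of `ℝ^d`. -/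
def klEstimate {d N : ℕ} (x : Fin N → EuclideanSpace ℝ (Fin d)) : ℝ :=
  (d : ℝ) * Real.log (meanDist x) + Real.log (ballVol d) + eulerGamma + Real.log ((N : ℝ) - 1)

/-- `G(t) = 0` for `t < 1` and `G(t) = t log t` for `t ≥ 1`. -/
def G (t : ℝ) : ℝ :=
  if t < 1 then 0 else t * Real.log t

/-- The average of `f` over the closed ball of radius `r` centred at `x`. -/
def ballAvg {d : ℕ} (f : EuclideanSpace ℝ (Fin d) → ℝ) (x : EuclideanSpace ℝ (Fin d))
    (r : ℝ) : ℝ≥0∞ :=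
  (∫⁻ y in Metric.closedBall x r, ENNReal.ofReal (f y)) / ENNReal.ofReal (r ^ d * ballVol d)

/-- The supremum of the averages over the balls of radius `r ∈ (0, R]`. -/
def maxAvg {d : ℕ} (f : EuclideanSpace ℝ (Fin d) → ℝ) (x : EuclideanSpace ℝ (Fin d))
    (R : ℝ) : ℝ≥0∞ :=
  ⨆ r ∈ Set.Ioc (0 : ℝ) R, ballAvg f x r

/-- The infimum of the averages over the balls of radius `r ∈ (0, R]`. -/
def minAvg {d : ℕ} (f : EuclideanSpace ℝ (Fin d) → ℝ) (x : EuclideanSpace ℝ (Fin d))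
    (R : ℝ) : ℝ≥0∞ :=
  ⨅ r ∈ Set.Ioc (0 : ℝ) R, ballAvg f x r

/-- `K_f(ε)`; the inner integral omits the point `y = x`, where `log ‖x - y‖` is undefined. -/
def K {d : ℕ} (f : EuclideanSpace ℝ (Fin d) → ℝ) (ε : ℝ) : ℝ≥0∞ :=
  ∫⁻ x, (∫⁻ y in {x}ᶜ, ENNReal.ofReal (G |Real.log (dist x y)|) * ENNReal.ofReal (f y)) ^ (1 + ε)
    * ENNReal.ofReal (f x)

/-- `Q_f(ε, R)`. -/
def Q {d : ℕ} (f : EuclideanSpace ℝ (Fin d) → ℝ) (ε R : ℝ) : ℝ≥0∞ :=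
  ∫⁻ x, maxAvg f x R ^ ε * ENNReal.ofReal (f x)

/-- `T_f(ε, R)`; for `ε > 0` the power `0 ^ (-ε)` is `∞`, and points with `f x = 0`
contribute nothing (`∞ * 0 = 0`). -/
def T {d : ℕ} (f : EuclideanSpace ℝ (Fin d) → ℝ) (ε R : ℝ) : ℝ≥0∞ :=
  ∫⁻ x, minAvg f x R ^ (-ε) * ENNReal.ofReal (f x)

end

end KozachenkoLeonenko

open KozachenkoLeonenko

/-
Up to the additive constant `γ`, the estimate averages `log (n * V_d * ρ ^ d)` over the sample
points, where `ρ` is the distance from a point to the nearest of the `n = N - 1` others. Given that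
the point is `x`, the event `n * V_d * ρ ^ d > u` has probability `(1 - P (B (x, r))) ^ n`, where
`B (x, r)` has volume `u / n`, and by Lebesgue differentiation this tends to `exp (-u * f x)`. Hence
`n * V_d * ρ ^ d` converges in law to `τ / f X` with `τ` standard exponential and independent of
`X`, and `E log (τ / f X) = H - γ`. Integrating `(P (U > u) - [u < 1]) / u` over `u > 0` gives
`E log U`, so convergence of the means follows from uniform bounds on the tails. With `ρ` truncated
at `R`, the finiteness of `Q` bounds the probability of `U ≤ u` by a power of `u` (union bound), and
that of `T` bounds the probability of `U > u` by a negative power of `u`. The remaining term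
`d * log⁺ (ρ / R)` is dominated by one integrable distance, as a finite `K` forces
`E log⁺ ‖X‖ < ∞`, and it vanishes in the limit because `ρ` tends to `0`.
-/

namespace KozachenkoLeonenko

section LogTail

/-- The integrand of the representation `log s = ∫ u in (0, ∞), ([u < s] - [u < 1]) / u`. -/
noncomputable def logKernel (s u : ℝ) : ℝ :=
  ((if u < s then 1 else 0) - if u < 1 then 1 else 0) / u

/-- The mean of `logKernel · u` under the law `ν`, whose integral over `u > 0` is the mean of the
logarithm. -/
noncomputable def logTail (ν : Measure ℝ) (u : ℝ) : ℝ :=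
  (ν.real (Set.Ioi u) - if u < 1 then 1 else 0) / u

lemma measurable_logKernel : Measurable (Function.uncurry logKernel) :=
  ((Measurable.ite (measurableSet_lt measurable_snd measurable_fst) measurable_const
      measurable_const).sub
    (Measurable.ite (measurableSet_lt measurable_snd measurable_const) measurable_const
      measurable_const)).div measurable_snd

lemma logKernel_eq_indicator (s u : ℝ) :
    logKernel s u =
      (Set.Ico 1 s).indicator (fun u => u⁻¹) u - (Set.Ico s 1).indicator (fun u => u⁻¹) u := by
  simp only [logKernel, Set.indicator, Set.mem_Ico]
  split_ifs <;> grind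

lemma integral_logKernel {s : ℝ} (hs : 0 < s) :
    ∫ u in Set.Ioi (0 : ℝ), logKernel s u = Real.log s := by
  have hinv : IntervalIntegrable (fun u : ℝ => u⁻¹) volume 1 s :=
    intervalIntegrable_inv_iff.2 (Or.inr (Set.notMem_uIcc_of_lt one_pos hs))
  have hIco : ∀ {a b : ℝ}, 0 < a → IntegrableOn (fun u : ℝ => u⁻¹) (Set.Ioc a b) →
      IntegrableOn ((Set.Ico a b).indicator fun u => u⁻¹) (Set.Ioi 0) ∧
      ∫ u in Set.Ioi (0 : ℝ), (Set.Ico a b).indicator (fun u => u⁻¹) u =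
        ∫ u in Set.Ioc a b, u⁻¹ := by
    intro a b ha h
    have hsub : Set.Ico a b ⊆ Set.Ioi 0 := fun u hu => ha.trans_le hu.1
    refine ⟨((integrable_indicator_iff measurableSet_Ico).2
      ((integrableOn_Ico_iff_integrableOn_Ioo).2
        ((integrableOn_Ioc_iff_integrableOn_Ioo).1 h))).integrableOn, ?_⟩
    rw [setIntegral_indicator measurableSet_Ico, Set.inter_eq_right.2 hsub,
      integral_Ico_eq_integral_Ioc]
  obtain ⟨hint₁, heq₁⟩ := hIco one_pos hinv.1
  obtain ⟨hint₂, heq₂⟩ := hIco hs hinv.2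
  simp_rw [logKernel_eq_indicator]
  rw [integral_sub hint₁ hint₂, heq₁, heq₂, ← intervalIntegral, integral_inv_of_pos one_pos hs,
    div_one]

variable {ν : Measure ℝ}

lemma integrable_logKernel [IsFiniteMeasure ν] (u : ℝ) : Integrable (fun s => logKernel s u) ν :=
  ((Integrable.indicator (integrable_const (1 : ℝ)) (measurableSet_Ioi (a := u))).sub
    (integrable_const _)).div_const u

lemma integral_logKernel_measure [IsProbabilityMeasure ν] (u : ℝ) :
    ∫ s, logKernel s u ∂ν = logTail ν u := by
  have htail : ∫ s, (if u < s then (1 : ℝ) else 0) ∂ν = ν.real (Set.Ioi u) :=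
    integral_indicator_one measurableSet_Ioi
  simp only [logKernel]
  rw [integral_div, integral_sub _ (integrable_const _), htail, integral_const, probReal_univ,
    one_smul, logTail]
  exact Integrable.indicator (integrable_const (1 : ℝ)) (measurableSet_Ioi (a := u))

-- For fixed `u`, the sign of `logKernel s u` does not depend on `s`.
lemma integral_norm_logKernel [IsProbabilityMeasure ν] {u : ℝ} (hu : 0 < u) :
    ∫ s, ‖logKernel s u‖ ∂ν = ‖logTail ν u‖ := by
  rw [← integral_logKernel_measure]
  rcases lt_or_ge u 1 with h1 | h1
  · have hsign : ∀ s, logKernel s u ≤ 0 := fun s => by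
      refine div_nonpos_of_nonpos_of_nonneg ?_ hu.le
      split_ifs <;> norm_num
    rw [Real.norm_of_nonpos (integral_nonpos hsign), ← integral_neg]
    exact integral_congr_ae (ae_of_all _ fun s => Real.norm_of_nonpos (hsign s))
  · have hsign : ∀ s, 0 ≤ logKernel s u := fun s => by
      refine div_nonneg ?_ hu.le
      rw [if_neg h1.not_gt, sub_zero]
      positivity
    rw [Real.norm_of_nonneg (integral_nonneg hsign)]
    exact integral_congr_ae (ae_of_all _ fun s => Real.norm_of_nonneg (hsign s))

lemma integrable_logKernel_prod [IsProbabilityMeasure ν]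
    (hint : IntegrableOn (logTail ν) (Set.Ioi 0)) :
    Integrable (Function.uncurry logKernel) (ν.prod (volume.restrict (Set.Ioi 0))) := by
  rw [integrable_prod_iff' measurable_logKernel.aestronglyMeasurable]
  refine ⟨ae_of_all _ fun u => integrable_logKernel u, hint.norm.congr ?_⟩
  filter_upwards [ae_restrict_mem measurableSet_Ioi] with u hu
  exact (integral_norm_logKernel hu).symm

lemma integrable_log_of_integrableOn_logTail [IsProbabilityMeasure ν] (hpos : ∀ᵐ s ∂ν, 0 < s)
    (hint : IntegrableOn (logTail ν) (Set.Ioi 0)) : Integrable Real.log ν :=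
  (integrable_logKernel_prod hint).integral_prod_left.congr
    (hpos.mono fun _ hs => integral_logKernel hs)

lemma integral_log_eq_integral_logTail [IsProbabilityMeasure ν] (hpos : ∀ᵐ s ∂ν, 0 < s)
    (hint : IntegrableOn (logTail ν) (Set.Ioi 0)) :
    ∫ s, Real.log s ∂ν = ∫ u in Set.Ioi (0 : ℝ), logTail ν u := by
  calc ∫ s, Real.log s ∂ν
      = ∫ s, (∫ u in Set.Ioi (0 : ℝ), logKernel s u) ∂ν :=
        integral_congr_ae (hpos.mono fun s hs => (integral_logKernel hs).symm)
    _ = ∫ u in Set.Ioi (0 : ℝ), (∫ s, logKernel s u ∂ν) :=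
        integral_integral_swap (integrable_logKernel_prod hint)
    _ = ∫ u in Set.Ioi (0 : ℝ), logTail ν u := by simp_rw [integral_logKernel_measure]

lemma measurable_logTail [IsFiniteMeasure ν] : Measurable (logTail ν) := by
  have htail : Antitone fun u => ν.real (Set.Ioi u) := fun u v huv =>
    measureReal_mono (Set.Ioi_subset_Ioi huv)
  exact (htail.measurable.sub (Measurable.ite measurableSet_Iio measurable_const
    measurable_const)).div measurable_id

lemma integrableOn_logTail_of_norm_le [IsFiniteMeasure ν] {g : ℝ → ℝ}
    (hg : IntegrableOn g (Set.Ioi 0)) (hle : ∀ u, 0 < u → ‖logTail ν u‖ ≤ g u) :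
    IntegrableOn (logTail ν) (Set.Ioi 0) :=
  hg.mono' measurable_logTail.aestronglyMeasurable
    ((ae_restrict_iff' measurableSet_Ioi).2 (ae_of_all _ hle))

/-- A dominating function for tails of order `u ^ (-b)` at infinity whose complements are of order
`u ^ a` at zero. -/
noncomputable def tailBound (a A b B u : ℝ) : ℝ :=
  if u < 1 then u ^ (a - 1) * A else u ^ (-b - 1) * B

lemma integrableOn_tailBound {a A b B : ℝ} (ha : 0 < a) (hb : 0 < b) :
    IntegrableOn (tailBound a A b B) (Set.Ioi 0) := by
  rw [← Set.Ioo_union_Ici_eq_Ioi one_pos]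
  refine IntegrableOn.union ?_ ?_
  · have hnear : IntegrableOn (fun u : ℝ => u ^ (a - 1) * A) (Set.Ioo 0 1) :=
      ((intervalIntegral.integrableOn_Ioo_rpow_iff one_pos).2 (by linarith)).mul_const A
    exact hnear.congr_fun (fun u hu => (if_pos hu.2).symm) measurableSet_Ioo
  · have hfar : IntegrableOn (fun u : ℝ => u ^ (-b - 1) * B) (Set.Ici 1) :=
      ((integrableOn_Ici_iff_integrableOn_Ioi).2
        (integrableOn_Ioi_rpow_of_lt (by linarith) one_pos)).mul_const B
    exact hfar.congr_fun (fun u hu => (if_neg (Set.mem_Ici.1 hu).not_gt).symm) measurableSet_Ici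

lemma norm_logTail_le_tailBound [IsProbabilityMeasure ν] {a A b B u : ℝ} (hu : 0 < u)
    (hnear : u < 1 → ν.real (Set.Iic u) ≤ u ^ a * A)
    (hfar : 1 ≤ u → ν.real (Set.Ioi u) ≤ u ^ (-b) * B) :
    ‖logTail ν u‖ ≤ tailBound a A b B u := by
  rw [logTail, norm_div, Real.norm_of_nonneg hu.le, div_le_iff₀ hu, tailBound]
  split_ifs with h
  · rw [mul_right_comm, Real.rpow_sub_one hu.ne', div_mul_cancel₀ _ hu.ne', norm_sub_rev,
      ← probReal_compl_eq_one_sub measurableSet_Ioi, Set.compl_Ioi,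
      Real.norm_of_nonneg measureReal_nonneg]
    exact hnear h
  · rw [mul_right_comm, Real.rpow_sub_one hu.ne', div_mul_cancel₀ _ hu.ne', sub_zero,
      Real.norm_of_nonneg measureReal_nonneg]
    exact hfar (not_lt.1 h)

variable {ι : Type*} {l : Filter ι} {νs : ι → Measure ℝ} {g : ℝ → ℝ}

lemma tendsto_logTail {u : ℝ}
    (hlim : Tendsto (fun i => (νs i).real (Set.Ioi u)) l (𝓝 (ν.real (Set.Ioi u)))) :
    Tendsto (fun i => logTail (νs i) u) l (𝓝 (logTail ν u)) :=
  (hlim.sub_const _).div_const _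

theorem integrable_log_of_tendsto_tail [l.NeBot] [IsProbabilityMeasure ν]
    (hpos : ∀ᵐ s ∂ν, 0 < s) (hg : IntegrableOn g (Set.Ioi 0))
    (hle : ∀ᶠ i in l, ∀ u, 0 < u → ‖logTail (νs i) u‖ ≤ g u)
    (hlim : ∀ u, 0 < u →
      Tendsto (fun i => (νs i).real (Set.Ioi u)) l (𝓝 (ν.real (Set.Ioi u)))) :
    Integrable Real.log ν :=
  integrable_log_of_integrableOn_logTail hpos <| integrableOn_logTail_of_norm_le hg fun u hu =>
    le_of_tendsto (tendsto_logTail (hlim u hu)).norm (hle.mono fun _ h => h u hu)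

theorem tendsto_integral_log_of_tendsto_tail [l.NeBot] [l.IsCountablyGenerated]
    [IsProbabilityMeasure ν] [∀ i, IsProbabilityMeasure (νs i)] (hpos : ∀ᵐ s ∂ν, 0 < s)
    (hpos' : ∀ᶠ i in l, ∀ᵐ s ∂νs i, 0 < s) (hg : IntegrableOn g (Set.Ioi 0))
    (hle : ∀ᶠ i in l, ∀ u, 0 < u → ‖logTail (νs i) u‖ ≤ g u)
    (hlim : ∀ u, 0 < u →
      Tendsto (fun i => (νs i).real (Set.Ioi u)) l (𝓝 (ν.real (Set.Ioi u)))) :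
    Tendsto (fun i => ∫ s, Real.log s ∂νs i) l (𝓝 (∫ s, Real.log s ∂ν)) := by
  have htail : ∀ u, 0 < u → Tendsto (fun i => logTail (νs i) u) l (𝓝 (logTail ν u)) :=
    fun u hu => tendsto_logTail (hlim u hu)
  have hint : IntegrableOn (logTail ν) (Set.Ioi 0) := integrableOn_logTail_of_norm_le hg
    fun u hu => le_of_tendsto (htail u hu).norm (hle.mono fun _ h => h u hu)
  rw [integral_log_eq_integral_logTail hpos hint]
  have hdom : Tendsto (fun i => ∫ u in Set.Ioi (0 : ℝ), logTail (νs i) u) l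
      (𝓝 (∫ u in Set.Ioi (0 : ℝ), logTail ν u)) :=
    tendsto_integral_filter_of_dominated_convergence g
      (Eventually.of_forall fun i => measurable_logTail.aestronglyMeasurable)
      (hle.mono fun i h => (ae_restrict_iff' measurableSet_Ioi).2 (ae_of_all _ h)) hg
      ((ae_restrict_iff' measurableSet_Ioi).2 (ae_of_all _ htail))
  refine hdom.congr' ?_
  filter_upwards [hpos', hle] with i hi hlei
  exact (integral_log_eq_integral_logTail hi (integrableOn_logTail_of_norm_le hg hlei)).symm

end LogTail

section MinDist

variable {E : Type*} [PseudoMetricSpace E] {n : ℕ}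

/-- The smallest distance from `x` to the points of the family `y`; it is `0` for `n = 0`. -/
noncomputable def minDist (x : E) (y : Fin n → E) : ℝ :=
  ⨅ k, dist x (y k)

lemma minDist_nonneg (x : E) (y : Fin n → E) : 0 ≤ minDist x y :=
  Real.iInf_nonneg fun _ => dist_nonneg

lemma minDist_le (x : E) (y : Fin n → E) (k : Fin n) : minDist x y ≤ dist x (y k) :=
  ciInf_le (Set.finite_range _).bddBelow k

lemma lt_minDist_iff [NeZero n] {r : ℝ} (x : E) (y : Fin n → E) :
    r < minDist x y ↔ ∀ k, r < dist x (y k) := by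
  refine ⟨fun h k => h.trans_le (minDist_le x y k), fun h => ?_⟩
  obtain ⟨k, hk⟩ := exists_eq_ciInf_of_finite (f := fun k => dist x (y k))
  exact (h k).trans_eq hk

lemma minDist_le_iff [NeZero n] {r : ℝ} (x : E) (y : Fin n → E) :
    minDist x y ≤ r ↔ ∃ k, dist x (y k) ≤ r := by
  rw [← not_lt, lt_minDist_iff, not_forall]
  simp only [not_lt]

variable [MeasurableSpace E]

/-- The joint law of a sample point and `n` further independent sample points. -/
noncomputable abbrev sampleLaw (μ : Measure E) (n : ℕ) : Measure (E × (Fin n → E)) :=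
  μ.prod (Measure.pi fun _ => μ)

variable [OpensMeasurableSpace E] {μ : Measure E} [IsProbabilityMeasure μ]

lemma measure_pi_forall_lt_dist (x : E) (r : ℝ) (n : ℕ) :
    (Measure.pi fun _ : Fin n => μ) {y | ∀ k, r < dist x (y k)} =
      (1 - μ (Metric.closedBall x r)) ^ n := by
  have hset : {y : Fin n → E | ∀ k, r < dist x (y k)} =
      Set.univ.pi fun _ => (Metric.closedBall x r)ᶜ := by
    ext y
    simp [dist_comm]
  rw [hset, Measure.pi_pi, Finset.prod_const, Finset.card_univ, Fintype.card_fin,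
    prob_compl_eq_one_sub Metric.isClosed_closedBall.measurableSet]

lemma measure_pi_minDist_le [NeZero n] (x : E) (r : ℝ) :
    (Measure.pi fun _ : Fin n => μ) {y | minDist x y ≤ r} ≤ n * μ (Metric.closedBall x r) := by
  have heval : ∀ k : Fin n, (Measure.pi fun _ : Fin n => μ)
      (Function.eval k ⁻¹' Metric.closedBall x r) = μ (Metric.closedBall x r) := fun k =>
    (measurePreserving_eval (fun _ : Fin n => μ) k).measure_preimage
      Metric.isClosed_closedBall.measurableSet.nullMeasurableSet
  calc (Measure.pi fun _ : Fin n => μ) {y | minDist x y ≤ r}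
      = (Measure.pi fun _ : Fin n => μ) (⋃ k, Function.eval k ⁻¹' Metric.closedBall x r) := by
        congr 1
        ext y
        simp [minDist_le_iff, dist_comm]
    _ ≤ ∑' k, (Measure.pi fun _ : Fin n => μ) (Function.eval k ⁻¹' Metric.closedBall x r) :=
        measure_iUnion_le _
    _ = n * μ (Metric.closedBall x r) := by simp [heval]

variable [SecondCountableTopology E]

lemma measurable_minDist : Measurable fun z : E × (Fin n → E) => minDist z.1 z.2 :=
  Measurable.iInf fun _ => measurable_fst.dist ((measurable_pi_apply _).comp measurable_snd)

lemma measurable_measure_closedBall (ν : Measure E) [SFinite ν] (r : ℝ) :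
    Measurable fun x => ν (Metric.closedBall x r) :=
  measurable_measure_prodMk_left (ν := ν) (s := {z : E × E | dist z.2 z.1 ≤ r})
    (measurableSet_le (measurable_snd.dist measurable_fst) measurable_const)

lemma measure_lt_minDist [NeZero n] (r : ℝ) :
    sampleLaw μ n {z | r < minDist z.1 z.2} =
      ∫⁻ x, (1 - μ (Metric.closedBall x r)) ^ n ∂μ := by
  rw [Measure.prod_apply (measurableSet_lt measurable_const measurable_minDist)]
  refine lintegral_congr fun x => ?_
  rw [← measure_pi_forall_lt_dist]
  simp only [Set.preimage, Set.mem_ofPred_eq, lt_minDist_iff]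

lemma measureReal_lt_minDist [NeZero n] (r : ℝ) :
    (sampleLaw μ n).real {z | r < minDist z.1 z.2} =
      ∫ x, (1 - μ.real (Metric.closedBall x r)) ^ n ∂μ := by
  rw [integral_eq_lintegral_of_nonneg_ae
    (ae_of_all _ fun x => pow_nonneg (sub_nonneg.2 measureReal_le_one) n)
    (((measurable_measure_closedBall μ r).ennreal_toReal.const_sub 1).pow_const
      n).aestronglyMeasurable, measureReal_def, measure_lt_minDist]
  congr 1
  refine lintegral_congr fun x => ?_
  rw [ENNReal.ofReal_pow (sub_nonneg.2 measureReal_le_one),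
    ENNReal.ofReal_sub _ measureReal_nonneg, ENNReal.ofReal_one, ofReal_measureReal]

lemma measure_minDist_le [NeZero n] (r : ℝ) {a : ℝ} (ha : 0 ≤ a) (ha1 : a ≤ 1) :
    sampleLaw μ n {z | minDist z.1 z.2 ≤ r} ≤
      ∫⁻ x, (n * μ (Metric.closedBall x r)) ^ a ∂μ := by
  rw [Measure.prod_apply (measurableSet_le measurable_minDist measurable_const)]
  refine lintegral_mono fun x => ?_
  calc (Measure.pi fun _ : Fin n => μ) {y | minDist x y ≤ r}
      = (Measure.pi fun _ : Fin n => μ) {y | minDist x y ≤ r} ^ (1 : ℝ) :=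
        (ENNReal.rpow_one _).symm
    _ ≤ (Measure.pi fun _ : Fin n => μ) {y | minDist x y ≤ r} ^ a :=
        ENNReal.rpow_le_rpow_of_exponent_ge prob_le_one ha1
    _ ≤ (n * μ (Metric.closedBall x r)) ^ a :=
        ENNReal.rpow_le_rpow (measure_pi_minDist_le x r) ha

-- `1 + t / a ≤ exp (t / a)` raised to the power `a`.
lemma exp_neg_le_rpow_neg {a t : ℝ} (ha : 0 < a) (ht : 0 < t) :
    Real.exp (-t) ≤ a ^ a * t ^ (-a) := by
  have hpow : t ^ a ≤ a ^ a * Real.exp t := by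
    calc t ^ a = a ^ a * (t / a) ^ a := by
          rw [← Real.mul_rpow ha.le (by positivity), mul_div_cancel₀ _ ha.ne']
      _ ≤ a ^ a * Real.exp (t / a) ^ a := by
          gcongr
          linarith [Real.add_one_le_exp (t / a)]
      _ = a ^ a * Real.exp t := by rw [← Real.exp_mul, div_mul_cancel₀ _ ha.ne']
  rw [Real.exp_neg, Real.rpow_neg ht.le, inv_le_iff_one_le_mul₀ (Real.exp_pos t), mul_right_comm,
    ← div_eq_mul_inv, one_le_div (by positivity)]
  exact hpow

lemma one_sub_pow_le_rpow_neg {p : ℝ≥0∞} (hp : p ≤ 1) (n : ℕ) {a : ℝ} (ha : 0 < a) :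
    (1 - p) ^ n ≤ ENNReal.ofReal (a ^ a) * (n * p) ^ (-a) := by
  have hC : 0 < a ^ a := Real.rpow_pos_of_pos ha a
  rcases eq_or_ne (n * p) 0 with h0 | h0
  · rw [h0, ENNReal.zero_rpow_of_neg (neg_lt_zero.2 ha), ENNReal.mul_top (by simpa using hC)]
    exact le_top
  lift p to NNReal using ne_top_of_le_ne_top ENNReal.one_ne_top hp
  have hp1 : (p : ℝ) ≤ 1 := mod_cast hp
  have hp0 : (0 : ℝ) < n * p := by
    rw [← NNReal.coe_natCast, ← NNReal.coe_mul, NNReal.coe_pos, pos_iff_ne_zero]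
    exact_mod_cast h0
  have hreal : (1 - (p : ℝ)) ^ n ≤ a ^ a * (n * p : ℝ) ^ (-a) :=
    calc (1 - (p : ℝ)) ^ n ≤ Real.exp (-p) ^ n :=
          pow_le_pow_left₀ (sub_nonneg.2 hp1) (Real.one_sub_le_exp_neg _) n
      _ = Real.exp (-(n * p)) := by rw [← Real.exp_nat_mul, mul_neg]
      _ ≤ a ^ a * (n * p : ℝ) ^ (-a) := exp_neg_le_rpow_neg ha hp0
  have hcast := ENNReal.ofReal_le_ofReal hreal
  rwa [ENNReal.ofReal_pow (sub_nonneg.2 hp1), ENNReal.ofReal_sub _ p.coe_nonneg,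
    ENNReal.ofReal_mul hC.le, ← ENNReal.ofReal_rpow_of_pos hp0,
    ENNReal.ofReal_mul n.cast_nonneg, ENNReal.ofReal_one, ENNReal.ofReal_natCast,
    ENNReal.ofReal_coe_nnreal] at hcast

lemma measure_lt_minDist_le [NeZero n] (r : ℝ) {a : ℝ} (ha : 0 < a) :
    sampleLaw μ n {z | r < minDist z.1 z.2} ≤
      ENNReal.ofReal (a ^ a) * ∫⁻ x, (n * μ (Metric.closedBall x r)) ^ (-a) ∂μ := by
  rw [measure_lt_minDist, ← lintegral_const_mul' _ _ ENNReal.ofReal_ne_top]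
  exact lintegral_mono fun x => one_sub_pow_le_rpow_neg prob_le_one n ha

lemma minDist_pos_ae {E : Type*} [MetricSpace E] [MeasurableSpace E] [OpensMeasurableSpace E]
    [SecondCountableTopology E] {μ : Measure E} [IsProbabilityMeasure μ] [NullSingletonClass μ]
    (n : ℕ) [NeZero n] : ∀ᵐ z ∂sampleLaw μ n, 0 < minDist z.1 z.2 := by
  have hone : sampleLaw μ n {z | 0 < minDist z.1 z.2} = 1 := by
    simp [measure_lt_minDist, Metric.closedBall_zero]
  exact (prob_compl_eq_zero_iff (measurableSet_lt measurable_const measurable_minDist)).2 hone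

section FarNeighbours

variable {g : ℝ → ℝ≥0∞} {R : ℝ}

-- If `g (minDist x y) ≠ 0`, then all the points of `y` are at distance more than `R` from `x`.
lemma lintegral_pi_minDist_succ_le (hg : Measurable g) (hmono : MonotoneOn g (Set.Ici 0))
    (hzero : ∀ t, 0 ≤ t → t ≤ R → g t = 0) (x : E) (n : ℕ) :
    ∫⁻ y, g (minDist x y) ∂Measure.pi (fun _ : Fin (n + 1) => μ) ≤
      (∫⁻ y, g (dist x y) ∂μ) * (1 - μ (Metric.closedBall x R)) ^ n := by
  set S : Set (Fin n → E) := {y | ∀ k, R < dist x (y k)} with hS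
  have hSm : MeasurableSet S := by
    rw [hS, Set.ofPred_forall]
    exact MeasurableSet.iInter fun k => measurableSet_lt measurable_const
      (measurable_const.dist (measurable_pi_apply k))
  have hind : Measurable (S.indicator (1 : (Fin n → E) → ℝ≥0∞)) := measurable_one.indicator hSm
  have hdist : Measurable fun y => g (dist x y) := hg.comp (measurable_const.dist measurable_id)
  have hle : ∀ y : Fin (n + 1) → E,
      g (minDist x y) ≤ g (dist x (y 0)) * S.indicator 1 (Fin.removeNth 0 y) := by
    intro y
    by_cases hy : Fin.removeNth 0 y ∈ S
    · rw [Set.indicator_of_mem hy, Pi.one_apply, mul_one]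
      exact hmono (minDist_nonneg x y) dist_nonneg (minDist_le x y 0)
    · obtain ⟨k, hk⟩ := not_forall.1 hy
      rw [hzero _ (minDist_nonneg x y) ((minDist_le x y k.succ).trans (not_lt.1 hk))]
      exact zero_le
  calc ∫⁻ y, g (minDist x y) ∂Measure.pi (fun _ : Fin (n + 1) => μ)
      ≤ ∫⁻ y, g (dist x (y 0)) * S.indicator 1 (Fin.removeNth 0 y)
          ∂Measure.pi (fun _ : Fin (n + 1) => μ) := lintegral_mono hle
    _ = ∫⁻ p, g (dist x p.1) * S.indicator 1 p.2 ∂sampleLaw μ n :=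
        (measurePreserving_piFinSuccAbove (fun _ : Fin (n + 1) => μ) 0).lintegral_comp
          ((hdist.comp measurable_fst).mul (hind.comp measurable_snd))
    _ = (∫⁻ y, g (dist x y) ∂μ) * (1 - μ (Metric.closedBall x R)) ^ n := by
        rw [lintegral_prod_mul hdist.aemeasurable hind.aemeasurable, lintegral_indicator_one hSm,
          measure_pi_forall_lt_dist]

lemma lintegral_minDist_succ_le (hg : Measurable g) (hmono : MonotoneOn g (Set.Ici 0))
    (hzero : ∀ t, 0 ≤ t → t ≤ R → g t = 0) (n : ℕ) :
    ∫⁻ z, g (minDist z.1 z.2) ∂sampleLaw μ (n + 1) ≤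
      ∫⁻ x, (∫⁻ y, g (dist x y) ∂μ) * (1 - μ (Metric.closedBall x R)) ^ n ∂μ := by
  have hgm : Measurable fun z : E × (Fin (n + 1) → E) => g (minDist z.1 z.2) :=
    hg.comp measurable_minDist
  rw [lintegral_prod _ hgm.aemeasurable]
  exact lintegral_mono fun x => lintegral_pi_minDist_succ_le hg hmono hzero x n

lemma lintegral_minDist_ne_top [NeZero n] (hg : Measurable g) (hmono : MonotoneOn g (Set.Ici 0))
    (hzero : ∀ t, 0 ≤ t → t ≤ R → g t = 0)
    (hfin : ∫⁻ x, ∫⁻ y, g (dist x y) ∂μ ∂μ ≠ ∞) :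
    ∫⁻ z, g (minDist z.1 z.2) ∂sampleLaw μ n ≠ ∞ := by
  obtain ⟨m, rfl⟩ := Nat.exists_eq_add_one_of_ne_zero (NeZero.ne n)
  refine ne_top_of_le_ne_top hfin ((lintegral_minDist_succ_le hg hmono hzero m).trans ?_)
  exact lintegral_mono fun x => mul_le_of_le_one_right' (pow_le_one' tsub_le_self m)

theorem tendsto_lintegral_minDist (hR : 0 < R) (hg : Measurable g)
    (hmono : MonotoneOn g (Set.Ici 0)) (hzero : ∀ t, 0 ≤ t → t ≤ R → g t = 0)
    (hfin : ∫⁻ x, ∫⁻ y, g (dist x y) ∂μ ∂μ ≠ ∞) :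
    Tendsto (fun n => ∫⁻ z, g (minDist z.1 z.2) ∂sampleLaw μ n) atTop (𝓝 0) := by
  have hinner : Measurable fun x => ∫⁻ y, g (dist x y) ∂μ :=
    Measurable.lintegral_prod_right' (f := fun p : E × E => g (dist p.1 p.2))
      (hg.comp measurable_dist)
  have hdom : Tendsto (fun n : ℕ => ∫⁻ x, (∫⁻ y, g (dist x y) ∂μ) *
      (1 - μ (Metric.closedBall x R)) ^ n ∂μ) atTop (𝓝 (∫⁻ _, 0 ∂μ)) := by
    refine tendsto_lintegral_of_dominated_convergence _
      (fun n => hinner.mul ((measurable_measure_closedBall μ R).const_sub 1 |>.pow_const n))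
      (fun n => ae_of_all _ fun x => mul_le_of_le_one_right' (pow_le_one' tsub_le_self n))
      hfin ?_
    filter_upwards [ae_lt_top hinner hfin, μ.support_mem_ae] with x hx hsupp
    have hball : 0 < μ (Metric.closedBall x R) :=
      (Measure.mem_support_iff_forall x).1 hsupp _ (Metric.closedBall_mem_nhds x hR)
    have hlt : 1 - μ (Metric.closedBall x R) < 1 :=
      ENNReal.sub_lt_self ENNReal.one_ne_top one_ne_zero hball.ne'
    simpa using ENNReal.Tendsto.const_mul (ENNReal.tendsto_pow_atTop_nhds_zero_of_lt_one hlt)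
      (Or.inr hx.ne)
  rw [lintegral_zero] at hdom
  rw [← tendsto_add_atTop_iff_nat 1]
  exact tendsto_of_tendsto_of_tendsto_of_le_of_le tendsto_const_nhds hdom
    (fun _ => zero_le) fun n => lintegral_minDist_succ_le hg hmono hzero n

end FarNeighbours

end MinDist

section LogMoment

variable {E : Type*} [SeminormedAddCommGroup E] {R : ℝ}

lemma posLog_dist_div_le (x y : E) (R : ℝ) :
    Real.posLog (dist x y / R) ≤
      Real.posLog R⁻¹ + Real.log 2 + Real.posLog ‖x‖ + Real.posLog ‖y‖ := by
  have hmul : Real.posLog (dist x y / R) ≤ Real.posLog (dist x y) + Real.posLog R⁻¹ := by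
    rw [div_eq_mul_inv]
    exact Real.posLog_mul
  have hdist : Real.posLog (dist x y) ≤ Real.posLog (‖x‖ + ‖y‖) :=
    Real.posLog_le_posLog dist_nonneg (dist_le_norm_add_norm x y)
  linarith [Real.posLog_add (x := ‖x‖) (y := ‖y‖)]

lemma posLog_div_eq_zero {t : ℝ} (hR : 0 < R) (ht : 0 ≤ t) (htR : t ≤ R) :
    Real.posLog (t / R) = 0 := by
  rw [Real.posLog_eq_zero_iff, abs_of_nonneg (by positivity)]
  exact (div_le_one hR).2 htR

lemma measurable_ofReal_posLog_div (R : ℝ) :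
    Measurable fun t => ENNReal.ofReal (Real.posLog (t / R)) :=
  (Real.continuous_posLog.measurable.comp (measurable_id.div_const R)).ennreal_ofReal

lemma monotoneOn_ofReal_posLog_div (hR : 0 ≤ R) :
    MonotoneOn (fun t => ENNReal.ofReal (Real.posLog (t / R))) (Set.Ici 0) := fun _ hs _ _ hst =>
  ENNReal.ofReal_le_ofReal
    (Real.posLog_le_posLog (div_nonneg hs hR) (div_le_div_of_nonneg_right hst hR))

variable [MeasurableSpace E] [OpensMeasurableSpace E] [SecondCountableTopology E]
  {μ : Measure E} [IsProbabilityMeasure μ]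

lemma lintegral_posLog_dist_ne_top (hμ : Integrable (fun x => Real.posLog ‖x‖) μ) (R : ℝ) :
    ∫⁻ x, ∫⁻ y, ENNReal.ofReal (Real.posLog (dist x y / R)) ∂μ ∂μ ≠ ∞ := by
  have hbound : Integrable (fun p : E × E =>
      Real.posLog R⁻¹ + Real.log 2 + Real.posLog ‖p.1‖ + Real.posLog ‖p.2‖) (μ.prod μ) :=
    ((integrable_const _).add (hμ.comp_fst μ)).add (hμ.comp_snd μ)
  have hmeas : Measurable fun p : E × E => ENNReal.ofReal (Real.posLog (dist p.1 p.2 / R)) :=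
    (measurable_ofReal_posLog_div R).comp measurable_dist
  rw [← lintegral_prod _ hmeas.aemeasurable]
  exact ne_top_of_le_ne_top hbound.lintegral_lt_top.ne
    (lintegral_mono fun p => ENNReal.ofReal_le_ofReal (posLog_dist_div_le p.1 p.2 R))

lemma measurable_posLog_minDist (n : ℕ) (R : ℝ) :
    Measurable fun z : E × (Fin n → E) => Real.posLog (minDist z.1 z.2 / R) :=
  Real.continuous_posLog.measurable.comp (measurable_minDist.div_const R)

lemma integrable_posLog_minDist (hμ : Integrable (fun x => Real.posLog ‖x‖) μ) (hR : 0 < R)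
    (n : ℕ) [NeZero n] :
    Integrable (fun z => Real.posLog (minDist z.1 z.2 / R)) (sampleLaw μ n) := by
  refine ⟨(measurable_posLog_minDist n R).aestronglyMeasurable, ?_⟩
  rw [hasFiniteIntegral_iff_ofReal (ae_of_all _ fun _ => Real.posLog_nonneg)]
  exact (lintegral_minDist_ne_top (measurable_ofReal_posLog_div R)
    (monotoneOn_ofReal_posLog_div hR.le)
    (fun t ht htR => by rw [posLog_div_eq_zero hR ht htR, ENNReal.ofReal_zero])
    (lintegral_posLog_dist_ne_top hμ R)).lt_top

theorem tendsto_integral_posLog_minDist (hμ : Integrable (fun x => Real.posLog ‖x‖) μ)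
    (hR : 0 < R) :
    Tendsto (fun n => ∫ z, Real.posLog (minDist z.1 z.2 / R) ∂sampleLaw μ n) atTop (𝓝 0) := by
  have hlim := tendsto_lintegral_minDist hR (measurable_ofReal_posLog_div R)
    (monotoneOn_ofReal_posLog_div hR.le)
    (fun t ht htR => by rw [posLog_div_eq_zero hR ht htR, ENNReal.ofReal_zero])
    (lintegral_posLog_dist_ne_top hμ R)
  refine ((ENNReal.tendsto_toReal ENNReal.zero_ne_top).comp hlim).congr fun n => ?_
  exact (integral_eq_lintegral_of_nonneg_ae (ae_of_all _ fun _ => Real.posLog_nonneg)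
    (measurable_posLog_minDist n R).aestronglyMeasurable).symm

end LogMoment

section BallAverages

variable {d n : ℕ} {f : EuclideanSpace ℝ (Fin d) → ℝ} {r R a : ℝ}

lemma ballVol_pos (d : ℕ) : 0 < ballVol d :=
  div_pos (Real.rpow_pos_of_pos Real.pi_pos _) (Real.Gamma_pos_of_pos (by positivity))

lemma volume_closedBall_eq [NeZero d] (x : EuclideanSpace ℝ (Fin d)) (hr : 0 ≤ r) :
    volume (Metric.closedBall x r) = ENNReal.ofReal (r ^ d * ballVol d) := by
  rw [EuclideanSpace.volume_closedBall, Fintype.card_fin, ENNReal.ofReal_mul (by positivity),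
    ENNReal.ofReal_pow hr, ballVol, Real.sqrt_eq_rpow, ← Real.rpow_mul_natCast Real.pi_pos.le]
  congr 4
  ring

lemma IsProbDensity.isProbabilityMeasure (hf : IsProbDensity f) :
    IsProbabilityMeasure (densityLaw f) := by
  refine ⟨?_⟩
  rw [densityLaw, withDensity_apply _ MeasurableSet.univ, Measure.restrict_univ,
    ← ofReal_integral_eq_lintegral_ofReal hf.integrable (ae_of_all _ hf.nonneg),
    hf.integral_eq_one, ENNReal.ofReal_one]

lemma densityLaw_absolutelyContinuous : densityLaw f ≪ volume :=
  withDensity_absolutelyContinuous _ _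

instance [NeZero d] : NullSingletonClass (densityLaw f) :=
  ⟨fun x => densityLaw_absolutelyContinuous (measure_singleton x)⟩

lemma IsProbDensity.aemeasurable (hf : IsProbDensity f) :
    AEMeasurable (fun x => ENNReal.ofReal (f x)) volume :=
  hf.integrable.aemeasurable.ennreal_ofReal

lemma IsProbDensity.lintegral_densityLaw (hf : IsProbDensity f)
    (g : EuclideanSpace ℝ (Fin d) → ℝ≥0∞) :
    ∫⁻ x, g x ∂densityLaw f = ∫⁻ x, g x * ENNReal.ofReal (f x) := by
  rw [densityLaw, lintegral_withDensity_eq_lintegral_mul_non_measurable₀ _ hf.aemeasurable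
    (ae_of_all _ fun x => ENNReal.ofReal_lt_top)]
  simp [mul_comm]

lemma ballAvg_eq (x : EuclideanSpace ℝ (Fin d)) (r : ℝ) :
    ballAvg f x r =
      densityLaw f (Metric.closedBall x r) / ENNReal.ofReal (r ^ d * ballVol d) := by
  rw [ballAvg, densityLaw, withDensity_apply _ Metric.isClosed_closedBall.measurableSet]

lemma ballAvg_le_maxAvg (x : EuclideanSpace ℝ (Fin d)) (hr : 0 < r) (hrR : r ≤ R) :
    ballAvg f x r ≤ maxAvg f x R :=
  le_iSup₂_of_le r ⟨hr, hrR⟩ le_rfl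

lemma minAvg_le_ballAvg (x : EuclideanSpace ℝ (Fin d)) (hr : 0 < r) (hrR : r ≤ R) :
    minAvg f x R ≤ ballAvg f x r :=
  iInf₂_le_of_le r ⟨hr, hrR⟩ le_rfl

lemma lintegral_rpow_ne_top_of_le {α : Type*} [MeasurableSpace α] {μ : Measure α}
    [IsFiniteMeasure μ] {g : α → ℝ≥0∞} {b : ℝ} (ha : 0 ≤ a) (hab : a ≤ b)
    (h : ∫⁻ x, g x ^ b ∂μ ≠ ∞) : ∫⁻ x, g x ^ a ∂μ ≠ ∞ := by
  have hsum : ∫⁻ x, (1 + g x ^ b) ∂μ ≠ ∞ := by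
    rw [lintegral_add_left measurable_const, lintegral_const, one_mul]
    exact ENNReal.add_ne_top.2 ⟨measure_ne_top _ _, h⟩
  refine ne_top_of_le_ne_top hsum (lintegral_mono fun x => ?_)
  rcases le_total (g x) 1 with hg | hg
  · exact (ENNReal.rpow_le_one hg ha).trans le_self_add
  · exact (ENNReal.rpow_le_rpow_of_exponent_le hg hab).trans le_add_self

lemma IsProbDensity.Q_ne_top_of_le (hf : IsProbDensity f) {b : ℝ} (ha : 0 ≤ a) (hab : a ≤ b)
    (hQ : Q f b R ≠ ∞) : Q f a R ≠ ∞ := by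
  have := hf.isProbabilityMeasure
  rw [Q, ← hf.lintegral_densityLaw] at hQ ⊢
  exact lintegral_rpow_ne_top_of_le ha hab hQ

/-- The volume of a ball of radius `r` in `ℝ^d`, multiplied by the number `n` of neighbours. -/
noncomputable def scaledVol (d n : ℕ) (r : ℝ) : ℝ :=
  n * ballVol d * r ^ d

/-- The radius of the ball of `ℝ^d` of volume `u / n`; it inverts `scaledVol d n`. -/
noncomputable def radius (d n : ℕ) (u : ℝ) : ℝ :=
  (u / (n * ballVol d)) ^ (1 / (d : ℝ))

lemma natCast_mul_ballVol_pos (d n : ℕ) [NeZero n] : 0 < n * ballVol d :=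
  mul_pos (Nat.cast_pos.2 (NeZero.pos n)) (ballVol_pos d)

lemma scaledVol_pos [NeZero n] (hr : 0 < r) : 0 < scaledVol d n r :=
  mul_pos (natCast_mul_ballVol_pos d n) (pow_pos hr d)

lemma measurable_scaledVol (d n : ℕ) : Measurable (scaledVol d n) :=
  (measurable_id.pow_const d).const_mul _

lemma radius_pos [NeZero n] {u : ℝ} (hu : 0 < u) : 0 < radius d n u :=
  Real.rpow_pos_of_pos (div_pos hu (natCast_mul_ballVol_pos d n)) _

lemma radius_le_radius {u v : ℝ} (hu : 0 ≤ u) (huv : u ≤ v) : radius d n u ≤ radius d n v := by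
  have := (ballVol_pos d).le
  unfold radius
  gcongr

lemma scaledVol_radius [NeZero d] [NeZero n] {u : ℝ} (hu : 0 ≤ u) :
    scaledVol d n (radius d n u) = u := by
  have hV := natCast_mul_ballVol_pos d n
  rw [scaledVol, radius, one_div, Real.rpow_inv_natCast_pow (by positivity) (NeZero.ne d),
    mul_div_cancel₀ _ hV.ne']

lemma lt_scaledVol_iff [NeZero d] [NeZero n] {u : ℝ} (hu : 0 < u) (hr : 0 ≤ r) :
    u < scaledVol d n r ↔ radius d n u < r := by
  conv_lhs => rw [← scaledVol_radius (d := d) (n := n) hu.le]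
  rw [scaledVol, scaledVol, mul_lt_mul_iff_right₀ (natCast_mul_ballVol_pos d n),
    pow_lt_pow_iff_left₀ (radius_pos hu).le hr (NeZero.ne d)]

lemma tendsto_radius [NeZero d] {u : ℝ} (hu : 0 < u) :
    Tendsto (fun n => radius d n u) atTop (𝓝[>] 0) := by
  refine tendsto_nhdsWithin_iff.2 ⟨?_, ?_⟩
  · have hvol : Tendsto (fun n : ℕ => u / (n * ballVol d)) atTop (𝓝 0) :=
      (tendsto_natCast_atTop_atTop.atTop_mul_const (ballVol_pos d)).const_div_atTop u
    have hd : (0 : ℝ) < 1 / d := one_div_pos.2 (Nat.cast_pos.2 (NeZero.pos d))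
    have hpow := hvol.rpow_const (p := 1 / (d : ℝ)) (Or.inr hd.le)
    rwa [Real.zero_rpow hd.ne'] at hpow
  · filter_upwards [eventually_ne_atTop 0] with n hn
    have : NeZero n := ⟨hn⟩
    exact radius_pos hu

lemma natCast_mul_densityLaw_closedBall (n : ℕ) (x : EuclideanSpace ℝ (Fin d)) (hr : 0 < r) :
    n * densityLaw f (Metric.closedBall x r) =
      ENNReal.ofReal (scaledVol d n r) * ballAvg f x r := by
  have hvol : 0 < r ^ d * ballVol d := mul_pos (pow_pos hr d) (ballVol_pos d)
  rw [ballAvg_eq, scaledVol, mul_assoc, mul_comm (ballVol d),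
    ENNReal.ofReal_mul (Nat.cast_nonneg n), ENNReal.ofReal_natCast, mul_assoc,
    ENNReal.mul_div_cancel (by simpa using hvol) ENNReal.ofReal_ne_top]

lemma measure_minDist_le_Q (hf : IsProbDensity f) [NeZero n] (hr : 0 < r) (hrR : r ≤ R)
    (ha : 0 ≤ a) (ha1 : a ≤ 1) :
    sampleLaw (densityLaw f) n {z | minDist z.1 z.2 ≤ r} ≤
      ENNReal.ofReal (scaledVol d n r ^ a) * Q f a R := by
  have := hf.isProbabilityMeasure
  refine (measure_minDist_le r ha ha1).trans ?_
  rw [Q, ← hf.lintegral_densityLaw, ← lintegral_const_mul' _ _ ENNReal.ofReal_ne_top]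
  refine lintegral_mono fun x => ?_
  rw [natCast_mul_densityLaw_closedBall n x hr, ENNReal.mul_rpow_of_nonneg _ _ ha,
    ENNReal.ofReal_rpow_of_pos (scaledVol_pos hr)]
  gcongr
  exact ballAvg_le_maxAvg x hr hrR

lemma measure_lt_minDist_le_T (hf : IsProbDensity f) [NeZero n] (hr : 0 < r) (hrR : r ≤ R)
    (ha : 0 < a) :
    sampleLaw (densityLaw f) n {z | r < minDist z.1 z.2} ≤
      ENNReal.ofReal (scaledVol d n r ^ (-a)) * (ENNReal.ofReal (a ^ a) * T f a R) := by
  have := hf.isProbabilityMeasure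
  have hvol : 0 < r ^ d * ballVol d := mul_pos (pow_pos hr d) (ballVol_pos d)
  refine (measure_lt_minDist_le r ha).trans ?_
  rw [mul_left_comm]
  gcongr
  rw [T, ← hf.lintegral_densityLaw, ← lintegral_const_mul' _ _ ENNReal.ofReal_ne_top]
  refine lintegral_mono fun x => ?_
  have havg : ballAvg f x r ≠ ∞ := by
    rw [ballAvg_eq]
    exact ENNReal.div_ne_top (measure_ne_top _ _) (by simpa using hvol)
  rw [natCast_mul_densityLaw_closedBall n x hr,
    ENNReal.mul_rpow_of_ne_top ENNReal.ofReal_ne_top havg,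
    ENNReal.ofReal_rpow_of_pos (scaledVol_pos hr), ENNReal.rpow_neg (ballAvg f x r),
    ENNReal.rpow_neg (minAvg f x R)]
  gcongr
  exact minAvg_le_ballAvg x hr hrR

end BallAverages

section TruncatedLaw

variable {d n : ℕ} {f : EuclideanSpace ℝ (Fin d) → ℝ} {R R₁ a b u : ℝ}

/-- The law of the scaled volume of the nearest neighbour ball of a sample point, its radius being
truncated at `R`: the density `f` is controlled by `Q` and `T` only at scales up to `R`. -/
noncomputable def truncLaw (f : EuclideanSpace ℝ (Fin d) → ℝ) (R : ℝ) (n : ℕ) : Measure ℝ :=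
  (sampleLaw (densityLaw f) n).map fun z => scaledVol d n (min (minDist z.1 z.2) R)

lemma measurable_truncVol (d n : ℕ) (R : ℝ) :
    Measurable fun z : EuclideanSpace ℝ (Fin d) × (Fin n → EuclideanSpace ℝ (Fin d)) =>
      scaledVol d n (min (minDist z.1 z.2) R) :=
  (measurable_scaledVol d n).comp (measurable_minDist.min measurable_const)

lemma isProbabilityMeasure_truncLaw (hf : IsProbDensity f) (R : ℝ) (n : ℕ) :
    IsProbabilityMeasure (truncLaw f R n) :=
  have := hf.isProbabilityMeasure
  Measure.isProbabilityMeasure_map (measurable_truncVol d n R).aemeasurable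

variable [NeZero d]

lemma ae_truncLaw_pos (hf : IsProbDensity f) (hR : 0 < R) [NeZero n] :
    ∀ᵐ s ∂truncLaw f R n, 0 < s := by
  have := hf.isProbabilityMeasure
  rw [truncLaw, ae_map_iff (measurable_truncVol d n R).aemeasurable measurableSet_Ioi]
  filter_upwards [minDist_pos_ae (μ := densityLaw f) n] with z hz
  exact scaledVol_pos (lt_min hz hR)

lemma truncLaw_Ioi [NeZero n] (hR : 0 < R) (hu : 0 < u) (huR : radius d n u < R) :
    truncLaw f R n (Set.Ioi u) =
      sampleLaw (densityLaw f) n {z | radius d n u < minDist z.1 z.2} := by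
  rw [truncLaw, Measure.map_apply (measurable_truncVol d n R) measurableSet_Ioi]
  congr 1
  ext z
  simp [lt_scaledVol_iff hu (le_min (minDist_nonneg z.1 z.2) hR.le), huR]

lemma truncLaw_Ioi_eq_zero [NeZero n] (hR : 0 < R) (hu : 0 < u) (huR : R ≤ radius d n u) :
    truncLaw f R n (Set.Ioi u) = 0 := by
  rw [truncLaw, Measure.map_apply (measurable_truncVol d n R) measurableSet_Ioi]
  refine measure_mono_null (fun z hz => ?_) measure_empty
  simp [lt_scaledVol_iff hu (le_min (minDist_nonneg z.1 z.2) hR.le), huR.not_gt] at hz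

lemma truncLaw_Iic [NeZero n] (hR : 0 < R) (hu : 0 < u) (huR : radius d n u < R) :
    truncLaw f R n (Set.Iic u) =
      sampleLaw (densityLaw f) n {z | minDist z.1 z.2 ≤ radius d n u} := by
  rw [truncLaw, Measure.map_apply (measurable_truncVol d n R) measurableSet_Iic]
  congr 1
  ext z
  simp [← not_lt, lt_scaledVol_iff hu (le_min (minDist_nonneg z.1 z.2) hR.le), huR]

lemma truncLaw_real_Iic_le (hf : IsProbDensity f) [NeZero n] (ha : 0 ≤ a) (ha1 : a ≤ 1)
    (hQ : Q f a R₁ ≠ ∞) (hR : 0 < R) (hu : 0 < u) (huR : radius d n u < R)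
    (huR₁ : radius d n u ≤ R₁) :
    (truncLaw f R n).real (Set.Iic u) ≤ u ^ a * (Q f a R₁).toReal := by
  have hle := measure_minDist_le_Q (n := n) hf (radius_pos hu) huR₁ ha ha1
  rw [← truncLaw_Iic hR hu huR, scaledVol_radius hu.le] at hle
  simpa [measureReal_def, ENNReal.toReal_ofReal (Real.rpow_nonneg hu.le a)] using
    ENNReal.toReal_mono (ENNReal.mul_ne_top ENNReal.ofReal_ne_top hQ) hle

lemma truncLaw_real_Ioi_le (hf : IsProbDensity f) [NeZero n] (hb : 0 < b)
    (hT : T f b R ≠ ∞) (hR : 0 < R) (hu : 0 < u) :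
    (truncLaw f R n).real (Set.Ioi u) ≤ u ^ (-b) * (b ^ b * (T f b R).toReal) := by
  rcases le_or_gt R (radius d n u) with huR | huR
  · rw [measureReal_def, truncLaw_Ioi_eq_zero hR hu huR, ENNReal.toReal_zero]
    positivity
  · have hle := measure_lt_minDist_le_T (n := n) hf (radius_pos hu) huR.le hb
    rw [← truncLaw_Ioi hR hu huR, scaledVol_radius hu.le] at hle
    simpa [measureReal_def, ENNReal.toReal_ofReal (Real.rpow_nonneg hu.le (-b)),
      ENNReal.toReal_ofReal (Real.rpow_nonneg hb.le b)] using
      ENNReal.toReal_mono (ENNReal.mul_ne_top ENNReal.ofReal_ne_top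
        (ENNReal.mul_ne_top ENNReal.ofReal_ne_top hT)) hle

lemma eventually_norm_logTail_truncLaw_le (hf : IsProbDensity f) (ha : 0 ≤ a) (ha1 : a ≤ 1)
    (hR₁ : 0 < R₁) (hQ : Q f a R₁ ≠ ∞) (hb : 0 < b) (hR : 0 < R) (hT : T f b R ≠ ∞) :
    ∀ᶠ n in atTop, ∀ u, 0 < u → ‖logTail (truncLaw f R n) u‖ ≤
      tailBound a (Q f a R₁).toReal b (b ^ b * (T f b R).toReal) u := by
  have hsmall : ∀ᶠ n in atTop, radius d n 1 < min R₁ R :=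
    (tendsto_nhdsWithin_iff.1 (tendsto_radius one_pos)).1.eventually_lt_const (lt_min hR₁ hR)
  filter_upwards [hsmall, eventually_ne_atTop 0] with n hn hn0 u hu
  have : NeZero n := ⟨hn0⟩
  have := isProbabilityMeasure_truncLaw hf R n
  refine norm_logTail_le_tailBound hu (fun hu1 => ?_) fun _ => truncLaw_real_Ioi_le hf hb hT hR hu
  have hlt : radius d n u < min R₁ R := (radius_le_radius hu.le hu1.le).trans_lt hn
  exact truncLaw_real_Iic_le hf ha ha1 hQ hR hu (hlt.trans_le (min_le_right _ _))
    (hlt.le.trans (min_le_left _ _))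

lemma tendsto_one_sub_measureReal_pow (hf : IsProbDensity f) (hu : 0 < u) :
    ∀ᵐ x ∂densityLaw f, Tendsto
      (fun n : ℕ => (1 - (densityLaw f).real (Metric.closedBall x (radius d n u))) ^ n) atTop
      (𝓝 (Real.exp (-(u * f x)))) := by
  have := hf.isProbabilityMeasure
  filter_upwards [densityLaw_absolutelyContinuous.ae_le
      (Besicovitch.ae_tendsto_rnDeriv (densityLaw f) volume),
    densityLaw_absolutelyContinuous.ae_le
      (Measure.rnDeriv_withDensity₀ volume hf.aemeasurable)] with x hlim hderiv
  rw [densityLaw, hderiv, ← densityLaw] at hlim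
  have hratio := ((ENNReal.tendsto_toReal ENNReal.ofReal_ne_top).comp
    (hlim.comp (tendsto_radius (d := d) hu))).const_mul u
  rw [ENNReal.toReal_ofReal (hf.nonneg x)] at hratio
  simp only [sub_eq_add_neg]
  refine Real.tendsto_one_add_pow_exp_of_tendsto (hratio.neg.congr' ?_)
  filter_upwards [eventually_ne_atTop 0] with n hn
  have : NeZero n := ⟨hn⟩
  have hr : 0 < radius d n u := radius_pos hu
  have hvol : 0 < radius d n u ^ d * ballVol d := mul_pos (pow_pos hr d) (ballVol_pos d)
  have hrad : n * ballVol d * radius d n u ^ d = u := scaledVol_radius hu.le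
  simp only [Function.comp, ENNReal.toReal_div, measureReal_def, volume_closedBall_eq x hr.le,
    ENNReal.toReal_ofReal hvol.le]
  rw [mul_neg, neg_inj, ← mul_div_assoc, div_eq_iff hvol.ne']
  linear_combination
    -(densityLaw f (Metric.closedBall x (radius d n u))).toReal * hrad

lemma tendsto_truncLaw_real_Ioi (hf : IsProbDensity f) (hR : 0 < R) (hu : 0 < u) :
    Tendsto (fun n => (truncLaw f R n).real (Set.Ioi u)) atTop
      (𝓝 (∫ x, Real.exp (-(u * f x)) ∂densityLaw f)) := by
  have := hf.isProbabilityMeasure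
  have hlim : Tendsto (fun n : ℕ => ∫ x, (1 - (densityLaw f).real
      (Metric.closedBall x (radius d n u))) ^ n ∂densityLaw f) atTop
      (𝓝 (∫ x, Real.exp (-(u * f x)) ∂densityLaw f)) := by
    refine tendsto_integral_of_dominated_convergence (fun _ => 1) (fun n => ?_)
      (integrable_const _) (fun n => ae_of_all _ fun x => ?_)
      (tendsto_one_sub_measureReal_pow hf hu)
    · exact (((measurable_measure_closedBall _ _).ennreal_toReal.const_sub 1).pow_const
        n).aestronglyMeasurable
    · have hbase : 0 ≤ 1 - (densityLaw f).real (Metric.closedBall x (radius d n u)) :=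
        sub_nonneg.2 measureReal_le_one
      rw [Real.norm_of_nonneg (pow_nonneg hbase n)]
      exact pow_le_one₀ hbase (sub_le_self _ measureReal_nonneg)
  refine hlim.congr' ?_
  filter_upwards [eventually_ne_atTop 0,
    (tendsto_nhdsWithin_iff.1 (tendsto_radius (d := d) hu)).1.eventually_lt_const hR] with n hn hnR
  have : NeZero n := ⟨hn⟩
  rw [← measureReal_lt_minDist, measureReal_def, measureReal_def, truncLaw_Ioi hR hu hnR]

end TruncatedLaw

section ExponentialLimit

lemma expMeasure_one_real_Ioi {v : ℝ} (hv : 0 ≤ v) :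
    (expMeasure 1).real (Set.Ioi v) = Real.exp (-v) := by
  have := isProbabilityMeasure_expMeasure one_pos
  rw [← Set.compl_Iic, probReal_compl_eq_one_sub measurableSet_Iic, ← cdf_eq_real,
    cdf_expMeasure_eq one_pos, if_pos hv]
  ring_nf

lemma ae_expMeasure_one_pos : ∀ᵐ t ∂expMeasure 1, 0 < t := by
  have := isProbabilityMeasure_expMeasure one_pos
  refine mem_ae_iff_prob_eq_one measurableSet_Ioi |>.2 ?_
  rw [← ENNReal.toReal_eq_one_iff, ← measureReal_def]
  exact (expMeasure_one_real_Ioi le_rfl).trans (by simp)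

lemma integral_log_expMeasure_one : ∫ t, Real.log t ∂expMeasure 1 = -eulerGamma := by
  have hdens : expMeasure 1 = volume.withDensity (exponentialPDF 1) := rfl
  have hmeas : Measurable (exponentialPDF 1) := (measurable_exponentialPDFReal 1).ennreal_ofReal
  rw [hdens, integral_withDensity_eq_integral_toReal_smul hmeas
      (ae_of_all _ fun _ => ENNReal.ofReal_lt_top), eulerGamma, neg_neg,
    ← integral_Ici_eq_integral_Ioi, ← integral_indicator measurableSet_Ici]
  congr 1 with t
  by_cases ht : 0 ≤ t <;> simp [exponentialPDF_eq, ht, (Real.exp_pos _).le]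

lemma integrable_of_integrable_snd_sub_fst {α β : Type*} [MeasurableSpace α] [MeasurableSpace β]
    {μ : Measure α} {ν : Measure β} [IsProbabilityMeasure μ] [IsProbabilityMeasure ν]
    {g : α → ℝ} {h : β → ℝ} (hint : Integrable (fun z => h z.2 - g z.1) (μ.prod ν)) :
    Integrable g μ ∧ Integrable h ν := by
  have hh : Integrable h ν := by
    obtain ⟨x, hx⟩ := hint.prod_right_ae.exists
    exact (hx.add (integrable_const (g x))).congr (ae_of_all _ fun y => sub_add_cancel _ _)
  have hg : Integrable (fun z : α × β => g z.1) (μ.prod ν) := by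
    exact ((hh.comp_snd μ).sub hint).congr (ae_of_all _ fun z => sub_sub_cancel _ _)
  exact ⟨(Integrable.comp_fst_iff (IsProbabilityMeasure.ne_zero ν)).1 hg, hh⟩

/-- The law of `τ / g X` for `X` of law `μ` and an independent standard exponential `τ`. -/
noncomputable def expQuotientLaw {α : Type*} [MeasurableSpace α] (μ : Measure α) (g : α → ℝ) :
    Measure ℝ :=
  (μ.prod (expMeasure 1)).map fun z => z.2 / g z.1

variable {α : Type*} [MeasurableSpace α] {μ : Measure α} {g : α → ℝ}

lemma aemeasurable_snd_div_fst (hg : AEMeasurable g μ) :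
    AEMeasurable (fun z => z.2 / g z.1) (μ.prod (expMeasure 1)) :=
  have := isProbabilityMeasure_expMeasure one_pos
  measurable_snd.aemeasurable.div hg.comp_fst

lemma ae_prod_pos_pos (hpos : ∀ᵐ x ∂μ, 0 < g x) :
    ∀ᵐ z ∂μ.prod (expMeasure 1), 0 < g z.1 ∧ 0 < z.2 :=
  have := isProbabilityMeasure_expMeasure one_pos
  (Measure.quasiMeasurePreserving_fst.ae hpos).and
    (Measure.quasiMeasurePreserving_snd.ae ae_expMeasure_one_pos)

lemma ae_expQuotientLaw_pos (hg : AEMeasurable g μ) (hpos : ∀ᵐ x ∂μ, 0 < g x) :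
    ∀ᵐ s ∂expQuotientLaw μ g, 0 < s := by
  rw [expQuotientLaw, ae_map_iff (aemeasurable_snd_div_fst hg) measurableSet_Ioi]
  exact (ae_prod_pos_pos hpos).mono fun z hz => div_pos hz.2 hz.1

variable [IsProbabilityMeasure μ]

lemma isProbabilityMeasure_expQuotientLaw (hg : AEMeasurable g μ) :
    IsProbabilityMeasure (expQuotientLaw μ g) :=
  have := isProbabilityMeasure_expMeasure one_pos
  Measure.isProbabilityMeasure_map (aemeasurable_snd_div_fst hg)

lemma expQuotientLaw_real_Ioi (hg : AEMeasurable g μ) (hpos : ∀ᵐ x ∂μ, 0 < g x) {u : ℝ}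
    (hu : 0 ≤ u) :
    (expQuotientLaw μ g).real (Set.Ioi u) = ∫ x, Real.exp (-(u * g x)) ∂μ := by
  have := isProbabilityMeasure_expMeasure one_pos
  have := isProbabilityMeasure_expQuotientLaw hg
  have hind : Integrable ((Set.Ioi u).indicator (1 : ℝ → ℝ)) (expQuotientLaw μ g) :=
    (integrable_const 1).indicator measurableSet_Ioi
  rw [← integral_indicator_one measurableSet_Ioi, expQuotientLaw,
    integral_map (aemeasurable_snd_div_fst hg) hind.aestronglyMeasurable,
    ← Function.comp_def, integral_prod _ (hind.comp_aemeasurable (aemeasurable_snd_div_fst hg))]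
  refine integral_congr_ae ?_
  filter_upwards [hpos] with x hx
  have hpre : (fun t => (Set.Ioi u).indicator (1 : ℝ → ℝ) (t / g x)) =
      (Set.Ioi (u * g x)).indicator 1 := by
    ext t
    simp [Set.indicator_apply, lt_div_iff₀ hx]
  simp only [Function.comp_apply, hpre]
  rw [integral_indicator_one measurableSet_Ioi, expMeasure_one_real_Ioi (by positivity)]

lemma integrable_log_expQuotientLaw (hg : AEMeasurable g μ) (hpos : ∀ᵐ x ∂μ, 0 < g x)
    (hlog : Integrable Real.log (expQuotientLaw μ g)) :
    Integrable (fun x => Real.log (g x)) μ ∧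
      ∫ s, Real.log s ∂expQuotientLaw μ g = -eulerGamma - ∫ x, Real.log (g x) ∂μ := by
  have := isProbabilityMeasure_expMeasure one_pos
  have hquot := aemeasurable_snd_div_fst hg
  have hdiv : (fun z : α × ℝ => Real.log (z.2 / g z.1)) =ᵐ[μ.prod (expMeasure 1)]
      fun z => Real.log z.2 - Real.log (g z.1) :=
    (ae_prod_pos_pos hpos).mono fun z hz => Real.log_div hz.2.ne' hz.1.ne'
  obtain ⟨hlogg, hlogexp⟩ := integrable_of_integrable_snd_sub_fst
    (g := fun x => Real.log (g x)) (h := Real.log) ((hlog.comp_aemeasurable hquot).congr hdiv)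
  refine ⟨hlogg, ?_⟩
  rw [expQuotientLaw, integral_map hquot hlog.aestronglyMeasurable, integral_congr_ae hdiv,
    integral_sub (hlogexp.comp_snd μ) (hlogg.comp_fst _), integral_fun_snd (f := Real.log),
    integral_fun_fst (f := fun x => Real.log (g x)), integral_log_expMeasure_one]
  simp

end ExponentialLimit

section Entropy

variable {d : ℕ} {f : EuclideanSpace ℝ (Fin d) → ℝ} {R R₁ a b : ℝ}

lemma IsProbDensity.ae_pos (hf : IsProbDensity f) : ∀ᵐ x ∂densityLaw f, 0 < f x :=
  (ae_withDensity_iff' hf.aemeasurable).2 (ae_of_all _ fun _ hx => by simpa using hx)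

lemma IsProbDensity.integrable_log_iff (hf : IsProbDensity f) :
    Integrable (fun x => Real.log (f x)) (densityLaw f) ↔
      Integrable (fun x => f x * Real.log (f x)) := by
  rw [densityLaw, integrable_withDensity_iff_integrable_smul₀' hf.aemeasurable
    (ae_of_all _ fun _ => ENNReal.ofReal_lt_top)]
  simp only [ENNReal.toReal_ofReal (hf.nonneg _), smul_eq_mul]

lemma IsProbDensity.integral_log (hf : IsProbDensity f) :
    ∫ x, Real.log (f x) ∂densityLaw f = -entropy f := by
  rw [entropy, neg_neg, densityLaw, integral_withDensity_eq_integral_toReal_smul₀ hf.aemeasurable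
    (ae_of_all _ fun _ => ENNReal.ofReal_lt_top)]
  simp only [ENNReal.toReal_ofReal (hf.nonneg _), smul_eq_mul]

variable [NeZero d]

lemma exists_integrableOn_bound_logTail_truncLaw (hf : IsProbDensity f) (ha : 0 < a)
    (hR₁ : 0 < R₁) (hQ : Q f a R₁ ≠ ∞) (hb : 0 < b) (hR : 0 < R) (hT : T f b R ≠ ∞) :
    ∃ g : ℝ → ℝ, IntegrableOn g (Set.Ioi 0) ∧
      ∀ᶠ n in atTop, ∀ u, 0 < u → ‖logTail (truncLaw f R n) u‖ ≤ g u :=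
  have ha' : 0 < min a 1 := lt_min ha one_pos
  ⟨_, integrableOn_tailBound ha' hb, eventually_norm_logTail_truncLaw_le hf ha'.le
    (min_le_right _ _) hR₁ (hf.Q_ne_top_of_le ha'.le (min_le_left _ _) hQ) hb hR hT⟩

lemma eventually_integrable_log_truncLaw (hf : IsProbDensity f) (ha : 0 < a)
    (hR₁ : 0 < R₁) (hQ : Q f a R₁ ≠ ∞) (hb : 0 < b) (hR : 0 < R) (hT : T f b R ≠ ∞) :
    ∀ᶠ n in atTop, Integrable Real.log (truncLaw f R n) := by
  obtain ⟨g, hg, hle⟩ := exists_integrableOn_bound_logTail_truncLaw hf ha hR₁ hQ hb hR hT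
  filter_upwards [hle, eventually_ne_atTop 0] with n hn hn0
  have : NeZero n := ⟨hn0⟩
  have := isProbabilityMeasure_truncLaw hf R n
  exact integrable_log_of_integrableOn_logTail (ae_truncLaw_pos hf hR)
    (integrableOn_logTail_of_norm_le hg hn)

lemma tendsto_truncLaw_expQuotientLaw (hf : IsProbDensity f) (hR : 0 < R) {u : ℝ} (hu : 0 < u) :
    Tendsto (fun n => (truncLaw f R n).real (Set.Ioi u)) atTop
      (𝓝 ((expQuotientLaw (densityLaw f) f).real (Set.Ioi u))) := by
  have := hf.isProbabilityMeasure
  rw [expQuotientLaw_real_Ioi (hf.integrable.aemeasurable.mono_ac densityLaw_absolutelyContinuous)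
    hf.ae_pos hu.le]
  exact tendsto_truncLaw_real_Ioi hf hR hu

lemma integrable_log_and_tendsto_integral_log_truncLaw (hf : IsProbDensity f) (ha : 0 < a)
    (hR₁ : 0 < R₁) (hQ : Q f a R₁ ≠ ∞) (hb : 0 < b) (hR : 0 < R) (hT : T f b R ≠ ∞) :
    Integrable (fun x => f x * Real.log (f x)) ∧
      Tendsto (fun n => ∫ s, Real.log s ∂truncLaw f R n) atTop (𝓝 (entropy f - eulerGamma)) := by
  have := hf.isProbabilityMeasure
  have hfm : AEMeasurable f (densityLaw f) :=
    hf.integrable.aemeasurable.mono_ac densityLaw_absolutelyContinuous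
  have := isProbabilityMeasure_expQuotientLaw hfm
  have := isProbabilityMeasure_truncLaw hf R
  obtain ⟨g, hg, hle⟩ := exists_integrableOn_bound_logTail_truncLaw hf ha hR₁ hQ hb hR hT
  have hpos := ae_expQuotientLaw_pos hfm hf.ae_pos
  have hlim : ∀ u, 0 < u → Tendsto (fun n => (truncLaw f R n).real (Set.Ioi u)) atTop
      (𝓝 ((expQuotientLaw (densityLaw f) f).real (Set.Ioi u))) :=
    fun u hu => tendsto_truncLaw_expQuotientLaw hf hR hu
  have hpos_trunc : ∀ᶠ n in atTop, ∀ᵐ s ∂truncLaw f R n, 0 < s := by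
    filter_upwards [eventually_ne_atTop 0] with n hn
    have : NeZero n := ⟨hn⟩
    exact ae_truncLaw_pos hf hR
  obtain ⟨hlogf, hlogint⟩ := integrable_log_expQuotientLaw hfm hf.ae_pos
    (integrable_log_of_tendsto_tail hpos hg hle hlim)
  refine ⟨hf.integrable_log_iff.1 hlogf, ?_⟩
  rw [show entropy f - eulerGamma = ∫ s, Real.log s ∂expQuotientLaw (densityLaw f) f by
    rw [hlogint, hf.integral_log]; ring]
  exact tendsto_integral_log_of_tendsto_tail hpos hpos_trunc hg hle hlim

end Entropy

section Estimator

variable {d n : ℕ} {f : EuclideanSpace ℝ (Fin d) → ℝ} {R R₁ a b : ℝ}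

lemma log_scaledVol [NeZero n] {r : ℝ} (hr : 0 < r) :
    Real.log (scaledVol d n r) = Real.log (n * ballVol d) + d * Real.log r := by
  rw [scaledVol, Real.log_mul (natCast_mul_ballVol_pos d n).ne' (pow_pos hr d).ne', Real.log_pow]

lemma log_scaledVol_eq_add_posLog [NeZero n] {r : ℝ} (hR : 0 < R) (hr : 0 < r) :
    Real.log (scaledVol d n r) =
      Real.log (scaledVol d n (min r R)) + d * Real.posLog (r / R) := by
  rcases le_total r R with hrR | hrR
  · rw [min_eq_left hrR, posLog_div_eq_zero hR hr.le hrR, mul_zero, add_zero]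
  · have hdiv : 1 ≤ |r / R| := by rwa [abs_of_pos (div_pos hr hR), one_le_div hR]
    rw [min_eq_right hrR, log_scaledVol hr, log_scaledVol hR, Real.posLog_eq_log hdiv,
      Real.log_div hr.ne' hR.ne']
    ring

lemma nearestDist_eq_minDist (x : Fin (n + 1) → EuclideanSpace ℝ (Fin d)) (i : Fin (n + 1)) :
    nearestDist x i = minDist (x i) (i.removeNth x) :=
  ((finSuccAboveEquiv i).iInf_congr fun _ => rfl).symm

lemma klEstimate_eq [NeZero n] {x : Fin (n + 1) → EuclideanSpace ℝ (Fin d)}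
    (hx : ∀ i, 0 < nearestDist x i) :
    klEstimate x =
      (∑ i, Real.log (scaledVol d n (nearestDist x i))) / (n + 1) + eulerGamma := by
  have hn : (n : ℝ) ≠ 0 := Nat.cast_ne_zero.2 (NeZero.ne n)
  rw [klEstimate, meanDist, Real.log_rpow (Finset.prod_pos fun i _ => hx i),
    Real.log_prod fun i _ => (hx i).ne']
  simp only [log_scaledVol (hx _), Real.log_mul hn (ballVol_pos d).ne', Finset.sum_add_distrib,
    Finset.sum_const, Finset.card_univ, Fintype.card_fin, nsmul_eq_mul, ← Finset.mul_sum,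
    Nat.cast_add, Nat.cast_one, add_sub_cancel_right]
  field_simp
  ring

lemma measurePreserving_apply_removeNth {E : Type*} [MeasurableSpace E] {μ : Measure E}
    [SigmaFinite μ] (i : Fin (n + 1)) :
    MeasurePreserving (fun x : Fin (n + 1) → E => (x i, i.removeNth x))
      (Measure.pi fun _ => μ) (sampleLaw μ n) :=
  measurePreserving_piFinSuccAbove (fun _ => μ) i

variable [NeZero d]

lemma integrable_log_scaledVol_minDist (hf : IsProbDensity f)
    (hlog : Integrable (fun x => Real.posLog ‖x‖) (densityLaw f)) (hR : 0 < R) [NeZero n]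
    (htrunc : Integrable Real.log (truncLaw f R n)) :
    Integrable (fun z => Real.log (scaledVol d n (minDist z.1 z.2)))
        (sampleLaw (densityLaw f) n) ∧
      ∫ z, Real.log (scaledVol d n (minDist z.1 z.2)) ∂sampleLaw (densityLaw f) n =
        ∫ s, Real.log s ∂truncLaw f R n +
          d * ∫ z, Real.posLog (minDist z.1 z.2 / R) ∂sampleLaw (densityLaw f) n := by
  have := hf.isProbabilityMeasure
  have hmeas := (measurable_truncVol d n R).aemeasurable (μ := sampleLaw (densityLaw f) n)
  have hnear := htrunc.comp_aemeasurable hmeas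
  have hfar := (integrable_posLog_minDist hlog hR n).const_mul (d : ℝ)
  have hsplit : (fun z => Real.log (scaledVol d n (minDist z.1 z.2)))
      =ᵐ[sampleLaw (densityLaw f) n] fun z =>
        Real.log (scaledVol d n (min (minDist z.1 z.2) R)) +
          d * Real.posLog (minDist z.1 z.2 / R) :=
    (minDist_pos_ae (μ := densityLaw f) n).mono fun z hz => log_scaledVol_eq_add_posLog hR hz
  refine ⟨(hnear.add hfar).congr hsplit.symm, ?_⟩
  rw [truncLaw, integral_map hmeas htrunc.aestronglyMeasurable, ← integral_const_mul,
    integral_congr_ae hsplit]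
  exact integral_add hnear hfar

lemma eventually_integrable_log_scaledVol_minDist (hf : IsProbDensity f) (ha : 0 < a)
    (hR₁ : 0 < R₁) (hQ : Q f a R₁ ≠ ∞) (hb : 0 < b) (hR : 0 < R) (hT : T f b R ≠ ∞)
    (hlog : Integrable (fun x => Real.posLog ‖x‖) (densityLaw f)) :
    ∀ᶠ n in atTop, Integrable (fun z => Real.log (scaledVol d n (minDist z.1 z.2)))
      (sampleLaw (densityLaw f) n) := by
  filter_upwards [eventually_integrable_log_truncLaw hf ha hR₁ hQ hb hR hT,
    eventually_ne_atTop 0] with n htrunc hn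
  have : NeZero n := ⟨hn⟩
  exact (integrable_log_scaledVol_minDist hf hlog hR htrunc).1

lemma tendsto_integral_log_scaledVol_minDist (hf : IsProbDensity f) (ha : 0 < a)
    (hR₁ : 0 < R₁) (hQ : Q f a R₁ ≠ ∞) (hb : 0 < b) (hR : 0 < R) (hT : T f b R ≠ ∞)
    (hlog : Integrable (fun x => Real.posLog ‖x‖) (densityLaw f)) :
    Tendsto (fun n => ∫ z, Real.log (scaledVol d n (minDist z.1 z.2))
      ∂sampleLaw (densityLaw f) n) atTop (𝓝 (entropy f - eulerGamma)) := by
  have := hf.isProbabilityMeasure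
  have hlim := (integrable_log_and_tendsto_integral_log_truncLaw hf ha hR₁ hQ hb hR hT).2.add
    ((tendsto_integral_posLog_minDist hlog hR).const_mul (d : ℝ))
  rw [mul_zero, add_zero] at hlim
  refine hlim.congr' ?_
  filter_upwards [eventually_integrable_log_truncLaw hf ha hR₁ hQ hb hR hT,
    eventually_ne_atTop 0] with n htrunc hn
  have : NeZero n := ⟨hn⟩
  exact (integrable_log_scaledVol_minDist hf hlog hR htrunc).2.symm

lemma ae_nearestDist_pos (hf : IsProbDensity f) [NeZero n] :
    ∀ᵐ x ∂Measure.pi fun _ : Fin (n + 1) => densityLaw f, ∀ i, 0 < nearestDist x i := by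
  have := hf.isProbabilityMeasure
  refine ae_all_iff.2 fun i => ?_
  simp only [nearestDist_eq_minDist]
  exact (measurePreserving_apply_removeNth i).quasiMeasurePreserving.ae
    (minDist_pos_ae (μ := densityLaw f) n)

lemma integrable_klEstimate (hf : IsProbDensity f) [NeZero n]
    (hint : Integrable (fun z => Real.log (scaledVol d n (minDist z.1 z.2)))
      (sampleLaw (densityLaw f) n)) :
    Integrable klEstimate (Measure.pi fun _ : Fin (n + 1) => densityLaw f) ∧
      ∫ x, klEstimate x ∂(Measure.pi fun _ : Fin (n + 1) => densityLaw f) =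
        ∫ z, Real.log (scaledVol d n (minDist z.1 z.2)) ∂sampleLaw (densityLaw f) n +
          eulerGamma := by
  have := hf.isProbabilityMeasure
  set μ := Measure.pi fun _ : Fin (n + 1) => densityLaw f
  have hterm : ∀ i, Integrable (fun x => Real.log (scaledVol d n (nearestDist x i))) μ := by
    intro i
    simp only [nearestDist_eq_minDist]
    exact (measurePreserving_apply_removeNth i).integrable_comp_of_integrable hint
  have hterm_int : ∀ i, ∫ x, Real.log (scaledVol d n (nearestDist x i)) ∂μ =
      ∫ z, Real.log (scaledVol d n (minDist z.1 z.2)) ∂sampleLaw (densityLaw f) n := by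
    intro i
    have hmp := measurePreserving_apply_removeNth (μ := densityLaw f) i
    rw [← hmp.map_eq, integral_map hmp.aemeasurable (hmp.map_eq ▸ hint.aestronglyMeasurable)]
    simp only [nearestDist_eq_minDist, μ]
  have hsum : Integrable (fun x => (∑ i, Real.log (scaledVol d n (nearestDist x i))) /
      ((n : ℝ) + 1)) μ :=
    (integrable_finsetSum _ fun i _ => hterm i).div_const _
  have hae := (ae_nearestDist_pos hf (n := n)).mono fun x hx => klEstimate_eq hx
  refine ⟨(hsum.add (integrable_const eulerGamma)).congr (EventuallyEq.symm hae), ?_⟩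
  rw [integral_congr_ae hae, integral_add hsum (integrable_const _), integral_div,
    integral_finsetSum _ fun i _ => hterm i]
  simp only [hterm_int, Finset.sum_const, Finset.card_univ, Fintype.card_fin, nsmul_eq_mul,
    Nat.cast_add, Nat.cast_one, integral_const, probReal_univ, one_smul]
  rw [mul_div_cancel_left₀ _ (by positivity)]

lemma eventually_integrable_klEstimate_comp (hf : IsProbDensity f) {Ω : Type*}
    [MeasurableSpace Ω] {P : Measure Ω} {X : ℕ → Ω → EuclideanSpace ℝ (Fin d)}
    (hlaw : ∀ i, HasLaw (X i) (densityLaw f) P) (hindep : iIndepFun X P)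
    (hint : ∀ᶠ n in atTop, Integrable (fun z => Real.log (scaledVol d n (minDist z.1 z.2)))
      (sampleLaw (densityLaw f) n)) :
    ∀ᶠ n : ℕ in atTop,
      Integrable (fun ω => klEstimate (fun i : Fin (n + 1) => X i ω)) P ∧
        ∫ ω, klEstimate (fun i : Fin (n + 1) => X i ω) ∂P =
          ∫ z, Real.log (scaledVol d n (minDist z.1 z.2)) ∂sampleLaw (densityLaw f) n +
            eulerGamma := by
  have := hf.isProbabilityMeasure
  filter_upwards [hint, eventually_ne_atTop 0] with n hint_n hn
  have : NeZero n := ⟨hn⟩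
  have hX : HasLaw (fun ω (i : Fin (n + 1)) => X i ω) (Measure.pi fun _ => densityLaw f) P :=
    (hindep.precomp Fin.val_injective).hasLaw_pi fun i => hlaw i
  obtain ⟨hkl, hkl_int⟩ := integrable_klEstimate hf hint_n
  rw [← hX.map_eq] at hkl
  refine ⟨hkl.comp_aemeasurable hX.aemeasurable, ?_⟩
  rw [← hkl_int, ← hX.map_eq, integral_map hX.aemeasurable hkl.aestronglyMeasurable]

end Estimator

section FarMoment

variable {d : ℕ} {f : EuclideanSpace ℝ (Fin d) → ℝ} {ε : ℝ}

lemma le_G_add_exp_one (s : ℝ) : s ≤ G s + Real.exp 1 := by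
  rw [G]
  split_ifs with hs
  · linarith [Real.exp_one_gt_two]
  · rw [not_lt] at hs
    have hs0 : 0 < s := one_pos.trans_le hs
    rcases le_total s (Real.exp 1) with hse | hse
    · linarith [mul_nonneg hs0.le (Real.log_nonneg hs)]
    · have hlog : 1 ≤ Real.log s := (Real.le_log_iff_exp_le hs0).2 hse
      linarith [le_mul_of_one_le_right hs0.le hlog, Real.exp_pos 1]

lemma posLog_norm_le_G_dist {E : Type*} [SeminormedAddCommGroup E] (x y : E) :
    Real.posLog ‖y‖ ≤
      G |Real.log (dist x y)| + (Real.exp 1 + Real.log 2 + Real.posLog ‖x‖) := by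
  have htri : Real.posLog ‖y‖ ≤ Real.posLog (‖x‖ + dist x y) :=
    Real.posLog_le_posLog (norm_nonneg y) (by
      rw [dist_eq_norm]
      exact norm_le_norm_add_norm_sub x y)
  have habs : Real.posLog (dist x y) ≤ |Real.log (dist x y)| :=
    max_le (abs_nonneg _) (le_abs_self _)
  linarith [Real.posLog_add (x := ‖x‖) (y := dist x y), le_G_add_exp_one |Real.log (dist x y)|]

lemma exists_lintegral_G_ne_top [NeZero d] (hf : IsProbDensity f) (hε : 0 < ε)
    (hK : K f ε ≠ ∞) :
    ∃ x, ∫⁻ y, ENNReal.ofReal (G |Real.log (dist x y)|) ∂densityLaw f ≠ ∞ := by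
  have := hf.isProbabilityMeasure
  by_contra! htop
  refine hK ?_
  simp only [hf.lintegral_densityLaw] at htop
  simp only [K, restrict_compl_singleton, htop,
    ENNReal.top_rpow_of_pos (by positivity : 0 < 1 + ε)]
  rw [← hf.lintegral_densityLaw, lintegral_const, measure_univ, mul_one]

lemma integrable_posLog_norm_of_K_ne_top [NeZero d] (hf : IsProbDensity f) (hε : 0 < ε)
    (hK : K f ε ≠ ∞) : Integrable (fun x => Real.posLog ‖x‖) (densityLaw f) := by
  have := hf.isProbabilityMeasure
  obtain ⟨x, hx⟩ := exists_lintegral_G_ne_top hf hε hK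
  set C := Real.exp 1 + Real.log 2 + Real.posLog ‖x‖
  refine ⟨(Real.continuous_posLog.comp continuous_norm).aestronglyMeasurable,
    (hasFiniteIntegral_iff_ofReal (ae_of_all _ fun _ => Real.posLog_nonneg)).2 ?_⟩
  calc ∫⁻ y, ENNReal.ofReal (Real.posLog ‖y‖) ∂densityLaw f
      ≤ ∫⁻ y, (ENNReal.ofReal (G |Real.log (dist x y)|) + ENNReal.ofReal C) ∂densityLaw f :=
        lintegral_mono fun y => (ENNReal.ofReal_le_ofReal (posLog_norm_le_G_dist x y)).trans
          ENNReal.ofReal_add_le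
    _ = ∫⁻ y, ENNReal.ofReal (G |Real.log (dist x y)|) ∂densityLaw f + ENNReal.ofReal C := by
        rw [lintegral_add_right _ measurable_const, lintegral_const, measure_univ, mul_one]
    _ < ∞ := ENNReal.add_lt_top.2 ⟨hx.lt_top, ENNReal.ofReal_lt_top⟩

end FarMoment

end KozachenkoLeonenko

theorem corollary1_general {d : ℕ} (hd : 1 ≤ d)
    (f : EuclideanSpace ℝ (Fin d) → ℝ) (hf : IsProbDensity f)
    {a b R₁ R₂ : ℝ} (ha : 0 < a) (hb : 0 < b) (hR₁ : 0 < R₁) (hR₂ : 0 < R₂)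
    (hlog : Integrable (fun x => Real.posLog ‖x‖) (densityLaw f))
    (hQ : KozachenkoLeonenko.Q f a R₁ < ∞)
    (hT : KozachenkoLeonenko.T f b R₂ < ∞)
    {Ω : Type*} [MeasurableSpace Ω] (P : Measure Ω)
    (X : ℕ → Ω → EuclideanSpace ℝ (Fin d))
    (hlaw : ∀ i, HasLaw (X i) (densityLaw f) P)
    (hindep : iIndepFun X P) :
    Integrable (fun x => f x * Real.log (f x)) volume ∧
    (∀ᶠ N : ℕ in atTop,
      Integrable (fun ω => klEstimate (fun i : Fin N => X i ω)) P) ∧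
    Tendsto (fun N : ℕ => ∫ ω, klEstimate (fun i : Fin N => X i ω) ∂P) atTop
      (𝓝 (entropy f)) := by
  have : NeZero d := ⟨by omega⟩
  have hsample := eventually_integrable_klEstimate_comp hf hlaw hindep
    (eventually_integrable_log_scaledVol_minDist hf ha hR₁ hQ.ne hb hR₂ hT.ne hlog)
  refine ⟨(integrable_log_and_tendsto_integral_log_truncLaw hf ha hR₁ hQ.ne hb hR₂ hT.ne).1,
    ?_, ?_⟩
  · rw [← map_add_atTop_eq_nat 1, eventually_map]
    exact hsample.mono fun n h => h.1
  · have hlim := (tendsto_integral_log_scaledVol_minDist hf ha hR₁ hQ.ne hb hR₂ hT.ne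
      hlog).add_const eulerGamma
    rw [sub_add_cancel] at hlim
    rw [← tendsto_add_atTop_iff_nat 1]
    exact hlim.congr' (hsample.mono fun n h => h.2.symm)

theorem corollary1 {d : ℕ} (hd : 1 ≤ d)
    (f : EuclideanSpace ℝ (Fin d) → ℝ) (hf : IsProbDensity f)
    (ε : ℝ) (hε : 0 < ε)
    (hK : KozachenkoLeonenko.K f ε < ∞)
    (hQ : KozachenkoLeonenko.Q f ε ε < ∞)
    (hT : KozachenkoLeonenko.T f ε ε < ∞)
    {Ω : Type*} [MeasurableSpace Ω] (P : Measure Ω) [IsProbabilityMeasure P]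
    (X : ℕ → Ω → EuclideanSpace ℝ (Fin d))
    (hlaw : ∀ i, HasLaw (X i) (densityLaw f) P)
    (hindep : iIndepFun X P) :
    Integrable (fun x => f x * Real.log (f x)) volume ∧
    (∀ᶠ N : ℕ in atTop,
      Integrable (fun ω => klEstimate (fun i : Fin N => X i ω)) P) ∧
    Tendsto (fun N : ℕ => ∫ ω, klEstimate (fun i : Fin N => X i ω) ∂P) atTop
      (𝓝 (entropy f)) := by
  have : NeZero d := ⟨by omega⟩
  exact corollary1_general hd f hf hε hε hε hε
    (integrable_posLog_norm_of_K_ne_top hf hε hK.ne) hQ hT P X hlaw hindep
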